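/- Let $A$ be a commutative ring (with $1$; the zero ring is allowed). Write $\operatorname{Spec}(A)$ for the prime spectrum with the Zariski topology and $\operatorname{Max}(A)$ for the subspace of maximal ideals; $D(f)=\{\mathfrak p\in\operatorname{Spec}(A): f\notin\mathfrak p\}$. For a prime ideal $\mathfrak p$, let $\pi_{\mathfrak p}:A\to A_{\mathfrak p}$ be the localization map and let $\Lambda(\mathfrak p)$ be the closure of $\{\mathfrak p\}$ in the flat topology of $\operatorname{Spec}(A)$ (the topology with sub-basis of opens $V(f)=\{\mathfrak q: f\in\mathfrak q\}$, $f\in A$); equivalently $\Lambda(\mathfrak p)=\{\mathfrak q\in\operatorname{Spec}(A):\mathfrak q\subseteq\mathfrak p\}$. For an $A$-algebra $B$ (commutative) and $\mathfrak m\in\operatorname{Max}(A)$, $B_{\mathfrak m}$ is the localization of $B$ at the image of $A\setminus\mathfrak m$. A system of equations over $B$ consists of finitely many equations $f_1=\dots=f_d=0$ with $f_i\in B[x_1,\dots,x_n]$; a solution in a $B$-algebra $C$ is an $n$-tuple in $C^n$ at which all $f_i$ vanish. The ring $A$ is clean if every element is the sum of an idempotent and an invertible element, and Gelfand if every prime ideal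 is contained in a unique maximal ideal. An ideal $I$ of $A$ is regular if it is generated by a set of idempotents, and pure if $A/I$ is flat over $A$. The Pierce spectrum $\operatorname{Sp}(A)$ is the set of maximal elements of the set of proper regular ideals of $A$, with the topology whose basic opens are $U_f=\{M\in\operatorname{Sp}(A): f\notin M\}$, $f\in A$ idempotent. Then the following are equivalent. (i) If a system of equations over an $A$-algebra $B$ has a solution in $B_{\mathfrak m}$ for every maximal ideal $\mathfrak m$ of $A$, then it has a solution in $B$. (ii) $A$ is a clean ring. (iii) If $\mathfrak m,\mathfrak m'$ are distinct maximal ideals of $A$, there is an idempotent $e\in A$ with $e\in\mathfrak m$ and $1-e\in\mathfrak m'$. (iv) $A$ is a Gelfand ring and $\operatorname{Max}(A)$ is totally disconnected in the Zariski topology. (v) $A$ is a Gelfand ring and $\operatorname{Ker}\pi_{\mathfrak m}$ is a regular ideal for every maximal ideal $\mathfrak m$ of $A$. (vi) The connected components of $\operatorname{Spec}(A)$ are precisely the sets $\Lambda(\mathfrak m)$ with $\mathfrak m$ a maximal ideal of $A$. (vii) $A$ is an exchange ring, i.e. for each $f\in A$ there is an idempotent $e\in A$ with $e\in Af$ and $1-e\in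 A(1-f)$. (viii) Idempotents of $A$ lift modulo each ideal: for every ideal $I$ of $A$, every idempotent of $A/I$ is the image of an idempotent of $A$. (ix) If $\mathfrak m,\mathfrak m'$ are distinct maximal ideals of $A$, there is an idempotent $e\in A$ with $e\in\operatorname{Ker}\pi_{\mathfrak m}$ and $1-e\in\operatorname{Ker}\pi_{\mathfrak m'}$. (x) The sets $D(e)\cap\operatorname{Max}(A)$, $e\in A$ idempotent, form a basis of the induced Zariski topology on $\operatorname{Max}(A)$. (xi) $A$ is a Gelfand ring and every pure ideal of $A$ is a regular ideal. (xii) The map $\lambda:\operatorname{Max}(A)\to\operatorname{Sp}(A)$ sending $\mathfrak m$ to the ideal generated by the idempotents contained in $\mathfrak m$ is a homeomorphism. -/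

import Mathlib

universe u v

namespace CleanRing

/-- A commutative ring is clean if every element is the sum of an idempotent and a unit. -/
def IsClean (A : Type u) [CommRing A] : Prop :=
  ∀ a : A, ∃ e u : A, IsIdempotentElem e ∧ IsUnit u ∧ a = e + u

/-- A commutative ring is Gelfand if every prime ideal lies in a unique maximal ideal. -/
def IsGelfand (A : Type u) [CommRing A] : Prop :=
  ∀ p : Ideal A, p.IsPrime → ∃! m : Ideal A, m.IsMaximal ∧ p ≤ m

/-- A commutative ring is exchange if for every `f` there is an idempotent `e ∈ Af` with
`1 - e ∈ A(1 - f)`. -/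
def IsExchange (A : Type u) [CommRing A] : Prop :=
  ∀ f : A, ∃ e : A, IsIdempotentElem e ∧ e ∈ Ideal.span {f} ∧ 1 - e ∈ Ideal.span {1 - f}

/-- The idempotents of `A` can be lifted along `φ : A → B`. -/
def IdempotentsLift {A : Type u} {B : Type v} [CommRing A] [CommRing B] (φ : A →+* B) : Prop :=
  ∀ e : B, IsIdempotentElem e → ∃ e' : A, IsIdempotentElem e' ∧ φ e' = e

/-- An ideal is regular if it is generated by a set of idempotents. -/
def IsRegularIdeal {A : Type u} [CommRing A] (I : Ideal A) : Prop :=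
  ∃ S : Set A, (∀ e ∈ S, IsIdempotentElem e) ∧ I = Ideal.span S

/-- A max-regular ideal: a maximal element of the set of proper regular ideals. -/
def IsMaxRegular {A : Type u} [CommRing A] (M : Ideal A) : Prop :=
  Maximal (fun I : Ideal A => I ≠ ⊤ ∧ IsRegularIdeal I) M

/-- The kernel of the canonical map from `A` to its localization at the prime ideal `p`. -/
def kerLoc {A : Type u} [CommRing A] (p : Ideal A) [p.IsPrime] : Ideal A :=
  RingHom.ker (algebraMap A (Localization.AtPrime p))

/-- A system of `d` polynomial equations in `n` unknowns over `B` has a solution in the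
`B`-algebra `C`. -/
def HasSolution {B : Type u} [CommRing B] {n d : ℕ} (f : Fin d → MvPolynomial (Fin n) B)
    (C : Type v) [CommRing C] [Algebra B C] : Prop :=
  ∃ c : Fin n → C, ∀ i : Fin d, MvPolynomial.aeval c (f i) = 0

/-- The localization `B_𝔪` of an `A`-algebra `B` at a maximal ideal `𝔪` of `A`: the image of
`A \ 𝔪` in `B` is inverted. -/
abbrev LocAt {A : Type u} [CommRing A] (B : Type v) [CommRing B] [Algebra A B]
    (m : MaximalSpectrum A) : Type v :=
  Localization (Algebra.algebraMapSubmonoid B m.asIdeal.primeCompl)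

/-- The flat (or inverse) topology on `Spec A`: the sets `V(f)`, `f ∈ A`, are a sub-basis of
opens. -/
abbrev flatTopology (A : Type u) [CommRing A] : TopologicalSpace (PrimeSpectrum A) :=
  TopologicalSpace.generateFrom (Set.range fun f : A => PrimeSpectrum.zeroLocus {f})

/-- `Λ(𝔭)`: the closure of the point `𝔭` of `Spec A` in the flat topology. -/
def Lam {A : Type u} [CommRing A] (p : PrimeSpectrum A) : Set (PrimeSpectrum A) :=
  @closure _ (flatTopology A) {p}

/-- `Λ(𝔭)` consists of the primes contained in `𝔭`. -/
theorem mem_Lam_iff {A : Type u} [CommRing A] (p q : PrimeSpectrum A) :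
    q ∈ Lam p ↔ q.asIdeal ≤ p.asIdeal := by
  let _ := flatTopology A
  change q ∈ closure {p} ↔ _
  rw [mem_closure_iff]
  constructor
  · intro h f hf
    obtain ⟨x, hx, rfl⟩ := h (PrimeSpectrum.zeroLocus {f})
      (TopologicalSpace.isOpen_generateFrom_of_mem ⟨f, rfl⟩) (by simpa using hf)
    simpa using hx
  · intro h o ho hq
    refine ⟨p, ?_, rfl⟩
    induction ho with
    | basic s hs =>
      obtain ⟨f, rfl⟩ := hs
      simp only [PrimeSpectrum.mem_zeroLocus, Set.singleton_subset_iff, SetLike.mem_coe] at hq ⊢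
      exact h hq
    | univ => trivial
    | inter s t _ _ ihs iht => exact ⟨ihs hq.1, iht hq.2⟩
    | sUnion S _ ih =>
      obtain ⟨t, ht, hqt⟩ := hq
      exact ⟨t, ht, ih t ht hqt⟩

/-- The Pierce spectrum of `A`: the set of max-regular ideals. -/
def PierceSpectrum (A : Type u) [CommRing A] : Type u :=
  {M : Ideal A // IsMaxRegular M}

/-- The topology of the Pierce spectrum, with the basic opens `{M | f ∉ M}`, `f` idempotent. -/
instance (A : Type u) [CommRing A] : TopologicalSpace (PierceSpectrum A) :=
  TopologicalSpace.generateFrom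
    {U | ∃ f : A, IsIdempotentElem f ∧ U = {M : PierceSpectrum A | f ∉ M.1}}

/-- The ideal generated by the idempotents of `I`. -/
def idemPart {A : Type u} [CommRing A] (I : Ideal A) : Ideal A :=
  Ideal.span {f : A | f ∈ I ∧ IsIdempotentElem f}

theorem isMaxRegular_idemPart {A : Type u} [CommRing A] (p : Ideal A) [hp : p.IsPrime] :
    IsMaxRegular (idemPart p) := by
  have hle : idemPart p ≤ p := Ideal.span_le.2 fun f hf => hf.1
  refine ⟨⟨fun h => hp.ne_top (top_le_iff.1 (h ▸ hle)), _, fun f hf => hf.2, rfl⟩, ?_⟩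
  rintro J ⟨hJ, S, hS, rfl⟩ hpJ
  refine Ideal.span_le.2 fun e he => ?_
  have hmul : e * (1 - e) ∈ p := by
    rw [mul_sub, mul_one, (hS e he).eq, sub_self]
    exact p.zero_mem
  rcases hp.mem_or_mem hmul with h | h
  · exact Ideal.subset_span ⟨h, hS e he⟩
  · exfalso
    apply hJ
    rw [Ideal.eq_top_iff_one]
    have h1 : 1 - e ∈ Ideal.span S := hpJ (Ideal.subset_span ⟨h, (hS e he).one_sub⟩)
    simpa using add_mem h1 (Ideal.subset_span he)

/-- The map `Max A → Sp A` sending `𝔪` to the ideal generated by the idempotents of `𝔪`. -/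
def maxToPierce (A : Type u) [CommRing A] (m : MaximalSpectrum A) : PierceSpectrum A :=
  ⟨idemPart m.asIdeal, isMaxRegular_idemPart m.asIdeal⟩

end CleanRing

namespace CleanRing

open PrimeSpectrum Topology

variable {A : Type u} [CommRing A]

/-! Everything passes through (iii), separation of maximal ideals by idempotents, and (vii), the
exchange property. A prime contains exactly one of `e` and `1 - e`, and the idempotents of an ideal
are closed under joins, so membership in the ideal they generate is witnessed by a single idempotent
(`exists_mul_eq_of_mem_idemPart`). This patches pointwise separation into exchange.

Conversely, exchange shrinks every basic neighbourhood `D(s)` of a maximal ideal to some `D(e)` with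
`e` idempotent (`IsExchange.exists_notMem`). Localizing at a maximal ideal is thereby replaced by
multiplying by idempotents, which yields regularity of the kernels, the basis of `Max A` and the
gluing of local solutions.

From (iv), a clopen subset of `Max A` is turned into an idempotent
(`IsGelfand.exists_isIdempotentElem`). Conditions (vi) and (xii) are (iii) read through `idemPart
m`, whose zero locus is the connected component of `m`. -/

/-- Distinct maximal ideals are separated by an idempotent. -/
def IdempotentsSeparateMax (A : Type u) [CommRing A] : Prop :=
  ∀ m m' : MaximalSpectrum A, m ≠ m' →
    ∃ e : A, IsIdempotentElem e ∧ e ∈ m.asIdeal ∧ 1 - e ∈ m'.asIdeal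

/-! ### Idempotents and ideals -/

theorem mem_or_one_sub_mem {p : Ideal A} [hp : p.IsPrime] {e : A} (he : IsIdempotentElem e) :
    e ∈ p ∨ 1 - e ∈ p := by
  refine hp.mem_or_mem ?_
  rw [mul_sub, mul_one, he.eq, sub_self]
  exact p.zero_mem

theorem one_sub_notMem {p : Ideal A} [hp : p.IsPrime] {e : A} (he : e ∈ p) : 1 - e ∉ p :=
  fun h => hp.ne_top ((Ideal.eq_top_iff_one p).2 (by simpa using add_mem h he))

theorem notMem_of_one_sub_mem {p : Ideal A} [p.IsPrime] {e : A} (he : 1 - e ∈ p) : e ∉ p :=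
  fun h => one_sub_notMem h he

theorem isIdempotentElem_join {e f : A} (he : IsIdempotentElem e) (hf : IsIdempotentElem f) :
    IsIdempotentElem (e + f - e * f) := by
  have he := he.eq
  have hf := hf.eq
  change (e + f - e * f) * (e + f - e * f) = _
  linear_combination (1 - 2 * f + f * f) * he + (1 - e) * hf

/-- If a set of idempotents is closed under joins, every element of the ideal it generates is
fixed by one of its members. -/
theorem exists_mul_eq_of_mem_span {S : Set A} (hS : ∀ e ∈ S, IsIdempotentElem e) (h0 : 0 ∈ S)
    (hjoin : ∀ e ∈ S, ∀ f ∈ S, e + f - e * f ∈ S) {g : A} (hg : g ∈ Ideal.span S) :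
    ∃ e ∈ S, g * e = g := by
  induction hg using Submodule.span_induction with
  | mem x hx => exact ⟨x, hx, hS x hx⟩
  | zero => exact ⟨0, h0, by simp⟩
  | add x y _ _ hx hy =>
    obtain ⟨e, he, hxe⟩ := hx
    obtain ⟨f, hf, hyf⟩ := hy
    exact ⟨_, hjoin e he f hf, by linear_combination (1 - f) * hxe + (1 - e) * hyf⟩
  | smul a x _ hx =>
    obtain ⟨e, he, hxe⟩ := hx
    exact ⟨e, he, by rw [smul_eq_mul, mul_assoc, hxe]⟩

theorem exists_mul_eq_of_mem_idemPart {I : Ideal A} {g : A} (hg : g ∈ idemPart I) :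
    ∃ e ∈ I, IsIdempotentElem e ∧ g * e = g := by
  obtain ⟨e, ⟨h1, h2⟩, h3⟩ := exists_mul_eq_of_mem_span (S := {f : A | f ∈ I ∧ IsIdempotentElem f})
    (fun e he => he.2) ⟨I.zero_mem, IsIdempotentElem.zero⟩ (fun e he f hf =>
      ⟨I.sub_mem (I.add_mem he.1 hf.1) (I.mul_mem_left _ hf.1),
        isIdempotentElem_join he.2 hf.2⟩) hg
  exact ⟨e, h1, h2, h3⟩

theorem idemPart_le (I : Ideal A) : idemPart I ≤ I :=
  Ideal.span_le.2 fun _ hf => hf.1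

theorem mem_idemPart_iff {I : Ideal A} {e : A} (he : IsIdempotentElem e) :
    e ∈ idemPart I ↔ e ∈ I :=
  ⟨fun h => idemPart_le I h, fun h => Ideal.subset_span ⟨h, he⟩⟩

theorem idemPart_le_iff {I J : Ideal A} :
    idemPart I ≤ J ↔ ∀ e ∈ I, IsIdempotentElem e → e ∈ J :=
  Ideal.span_le.trans ⟨fun h _ he hi => h ⟨he, hi⟩, fun h e he => h e he.1 he.2⟩

theorem idemPart_eq_of_le {p q : Ideal A} [p.IsPrime] [q.IsPrime] (h : p ≤ q) :
    idemPart p = idemPart q := by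
  refine le_antisymm (Ideal.span_mono fun e he => ⟨h he.1, he.2⟩) (idemPart_le_iff.2 ?_)
  intro e he hi
  refine (mem_idemPart_iff hi).2 ((mem_or_one_sub_mem hi).resolve_right fun h' => ?_)
  exact one_sub_notMem he (h h')

/-- Idempotents lift modulo an ideal generated by idempotents. -/
theorem idempotentsLift_idemPart (I : Ideal A) :
    IdempotentsLift (Ideal.Quotient.mk (idemPart I)) := by
  intro x hx
  obtain ⟨e, rfl⟩ := Ideal.Quotient.mk_surjective x
  have h : e * e - e ∈ idemPart I := by
    rw [← Ideal.Quotient.eq, map_mul]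
    exact hx
  obtain ⟨ε, hε, hi, hmul⟩ := exists_mul_eq_of_mem_idemPart h
  -- The factor `1 - ε` kills the defect `e * e - e` and is `1` modulo the ideal.
  refine ⟨e * (1 - ε), ?_, ?_⟩
  · have hi := hi.eq
    change e * (1 - ε) * (e * (1 - ε)) = e * (1 - ε)
    linear_combination e * e * hi - hmul
  · rw [Ideal.Quotient.eq]
    have : e * (1 - ε) - e = -e * ε := by ring
    rw [this]
    exact Ideal.mul_mem_left _ _ ((mem_idemPart_iff hi).2 hε)

theorem mem_kerLoc_iff {p : Ideal A} [p.IsPrime] {a : A} :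
    a ∈ kerLoc p ↔ ∃ s ∉ p, s * a = 0 := by
  rw [kerLoc, RingHom.mem_ker, IsLocalization.map_eq_zero_iff p.primeCompl]
  exact ⟨fun ⟨s, hs⟩ => ⟨s, s.2, hs⟩, fun ⟨s, hs, h⟩ => ⟨⟨s, hs⟩, h⟩⟩

theorem kerLoc_le (p : Ideal A) [hp : p.IsPrime] : kerLoc p ≤ p := by
  intro a ha
  obtain ⟨s, hs, h⟩ := mem_kerLoc_iff.1 ha
  exact (hp.mem_or_mem (h ▸ p.zero_mem : s * a ∈ p)).resolve_left hs

theorem mem_kerLoc_iff_of_isIdempotentElem {p : Ideal A} [p.IsPrime] {e : A}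
    (he : IsIdempotentElem e) : e ∈ kerLoc p ↔ e ∈ p :=
  ⟨fun h => kerLoc_le p h, fun h => mem_kerLoc_iff.2
    ⟨1 - e, one_sub_notMem h, by rw [sub_mul, one_mul, he.eq, sub_self]⟩⟩

/-! ### Exchange, clean, lifting of idempotents, separation of maximal ideals -/

/-- A compactness argument run twice: an ideal in no maximal ideal contains `1`, and an idempotent
then absorbs the unwanted summand of `1`. The first pass gives, at each maximal ideal containing `1
- f`, an idempotent multiple of `f` outside it; the second merges these into one. -/
theorem IdempotentsSeparateMax.isExchange (h : IdempotentsSeparateMax A) : IsExchange A := by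
  intro f
  have key : ∀ m' : Ideal A, m'.IsMaximal → 1 - f ∈ m' →
      ∃ e ∈ Ideal.span {f}, IsIdempotentElem e ∧ e ∉ m' := by
    intro m' hm' hf
    have htop : Ideal.span {f} ⊔ idemPart m' = ⊤ := by
      by_contra hne
      obtain ⟨m, hm, hle⟩ := Ideal.exists_le_maximal _ hne
      have hfm : f ∈ m := hle (Ideal.mem_sup_left (Ideal.mem_span_singleton_self f))
      obtain ⟨e, he, h1, h2⟩ := h ⟨m, hm⟩ ⟨m', hm'⟩ (by
        rintro ⟨⟩
        exact one_sub_notMem hfm hf)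
      exact one_sub_notMem h1 (hle (Ideal.mem_sup_right ((mem_idemPart_iff he.one_sub).2 h2)))
    obtain ⟨a, g, hg, hag⟩ := Ideal.mem_span_singleton_sup.1 ((Ideal.eq_top_iff_one _).1 htop)
    obtain ⟨e, he, hi, hge⟩ := exists_mul_eq_of_mem_idemPart hg
    refine ⟨1 - e, ?_, hi.one_sub, one_sub_notMem he⟩
    exact Ideal.mem_span_singleton'.2 ⟨(1 - e) * a, by linear_combination (1 - e) * hag + hge⟩
  have htop : Ideal.span {1 - f} ⊔ idemPart (Ideal.span {f}) = ⊤ := by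
    by_contra hne
    obtain ⟨m, hm, hle⟩ := Ideal.exists_le_maximal _ hne
    obtain ⟨e, h1, h2, h3⟩ :=
      key m hm (hle (Ideal.mem_sup_left (Ideal.mem_span_singleton_self _)))
    exact h3 (hle (Ideal.mem_sup_right ((mem_idemPart_iff h2).2 h1)))
  obtain ⟨b, g, hg, hbg⟩ := Ideal.mem_span_singleton_sup.1 ((Ideal.eq_top_iff_one _).1 htop)
  obtain ⟨e, he, hi, hge⟩ := exists_mul_eq_of_mem_idemPart hg
  exact ⟨e, hi, he,
    Ideal.mem_span_singleton'.2 ⟨(1 - e) * b, by linear_combination (1 - e) * hbg + hge⟩⟩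

theorem IsExchange.idempotentsLift (h : IsExchange A) (I : Ideal A) :
    IdempotentsLift (Ideal.Quotient.mk I) := by
  intro x hx
  obtain ⟨f, rfl⟩ := Ideal.Quotient.mk_surjective x
  have hf : f * f - f ∈ I := by
    rw [← Ideal.Quotient.eq, map_mul]
    exact hx
  obtain ⟨e, he, h1, h2⟩ := h f
  obtain ⟨a, ha⟩ := Ideal.mem_span_singleton'.1 h1
  obtain ⟨b, hb⟩ := Ideal.mem_span_singleton'.1 h2
  refine ⟨e, he, Ideal.Quotient.eq.2 ?_⟩
  -- Expand `e - f = e * (1 - f) - f * (1 - e)` with `e = a * f` and `1 - e = b * (1 - f)`.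
  have : e - f = (b - a) * (f * f - f) := by linear_combination f * hb - (1 - f) * ha
  rw [this]
  exact I.mul_mem_left _ hf

theorem exists_mem_one_sub_mem {m m' : MaximalSpectrum A} (hne : m ≠ m') :
    ∃ x ∈ m.asIdeal, 1 - x ∈ m'.asIdeal := by
  have h : m.asIdeal ⊔ m'.asIdeal = ⊤ :=
    m.isMaximal.coprime_of_ne m'.isMaximal fun h => hne (MaximalSpectrum.ext h)
  obtain ⟨x, hx, y, hy, hxy⟩ := Submodule.mem_sup.1 ((Ideal.eq_top_iff_one _).1 h)
  exact ⟨x, hx, by rwa [← hxy, add_sub_cancel_left]⟩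

/-- An element that is `0` modulo `m` and `1` modulo `m'` is idempotent modulo `m ⊓ m'`; any
idempotent lift separates them. -/
theorem idempotentsSeparateMax_of_lift
    (h : ∀ I : Ideal A, IdempotentsLift (Ideal.Quotient.mk I)) : IdempotentsSeparateMax A := by
  intro m m' hne
  obtain ⟨x, hx, hx'⟩ := exists_mem_one_sub_mem hne
  obtain ⟨e, he, hex⟩ := h (m.asIdeal ⊓ m'.asIdeal) (Ideal.Quotient.mk _ x) (by
    rw [IsIdempotentElem, ← map_mul, Ideal.Quotient.eq]
    have : x * x - x = -(x * (1 - x)) := by ring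
    rw [this]
    exact neg_mem ⟨Ideal.mul_mem_right _ _ hx, Ideal.mul_mem_left _ _ hx'⟩)
  obtain ⟨h1, h2⟩ := Ideal.Quotient.eq.1 hex
  refine ⟨e, he, by simpa using add_mem h1 hx, ?_⟩
  have : 1 - e = 1 - x - (e - x) := by ring
  rw [this]
  exact sub_mem hx' h2

theorem IsExchange.isClean (h : IsExchange A) : IsClean A := by
  intro a
  obtain ⟨e, he, h1, h2⟩ := h a
  obtain ⟨r, hr⟩ := Ideal.mem_span_singleton'.1 h1
  obtain ⟨s, hs⟩ := Ideal.mem_span_singleton'.1 h2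
  refine ⟨1 - e, a - (1 - e), he.one_sub, ?_, by ring⟩
  -- On the factor where `e = 1` the element is `a`, with inverse `r`; where `e = 0` it is `a - 1`,
  -- with inverse `-s`.
  refine IsUnit.of_mul_eq_one (r * e - s * (1 - e)) ?_
  have he := he.eq
  linear_combination e * hr + (1 - e) * hs + (r + s + 2) * he

/-- Since `x - e` is a unit, `e` differs from `x` modulo every maximal ideal: it is `1` at `m` and
`0` at `m'`. -/
theorem IsClean.idempotentsSeparateMax (h : IsClean A) : IdempotentsSeparateMax A := by
  intro m m' hne
  obtain ⟨x, hx, hx'⟩ := exists_mem_one_sub_mem hne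
  obtain ⟨e, w, he, hw, rfl⟩ := h x
  have hwm : ∀ n : MaximalSpectrum A, w ∉ n.asIdeal := fun n hn =>
    n.isMaximal.ne_top (Ideal.eq_top_of_isUnit_mem _ hn hw)
  refine ⟨1 - e, he.one_sub, (mem_or_one_sub_mem he).resolve_left fun h' => ?_, ?_⟩
  · exact hwm m (by simpa using sub_mem hx h')
  · rw [sub_sub_cancel]
    refine (mem_or_one_sub_mem he).resolve_right fun h' => hwm m' ?_
    simpa using sub_mem h' hx'

theorem IsExchange.idempotentsSeparateMax (h : IsExchange A) : IdempotentsSeparateMax A :=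
  idempotentsSeparateMax_of_lift h.idempotentsLift

theorem IsExchange.exists_notMem (h : IsExchange A) {m : Ideal A} (hm : m.IsMaximal) {s : A}
    (hs : s ∉ m) : ∃ e ∈ Ideal.span {s}, IsIdempotentElem e ∧ e ∉ m := by
  obtain ⟨a, y, hy, hay⟩ := hm.exists_inv hs
  obtain ⟨e, he, h1, h2⟩ := h (a * s)
  refine ⟨e, Ideal.span_singleton_le_span_singleton.2 ⟨a, mul_comm _ _⟩ h1, he, ?_⟩
  obtain ⟨b, hb⟩ := Ideal.mem_span_singleton'.1 h2
  refine notMem_of_one_sub_mem ?_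
  rw [← hb, ← hay, add_sub_cancel_left]
  exact m.mul_mem_left _ hy

theorem idempotentsSeparateMax_iff_kerLoc : IdempotentsSeparateMax A ↔
    ∀ m m' : MaximalSpectrum A, m ≠ m' →
      ∃ e : A, IsIdempotentElem e ∧ e ∈ kerLoc m.asIdeal ∧ 1 - e ∈ kerLoc m'.asIdeal := by
  refine forall₃_congr fun m m' _ => exists_congr fun e => and_congr_right fun he => ?_
  rw [mem_kerLoc_iff_of_isIdempotentElem he, mem_kerLoc_iff_of_isIdempotentElem he.one_sub]

/-! ### Gelfand rings -/

theorem IdempotentsSeparateMax.isGelfand (h : IdempotentsSeparateMax A) : IsGelfand A := by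
  intro p hp
  obtain ⟨m, hm, hpm⟩ := Ideal.exists_le_maximal p hp.ne_top
  refine ⟨m, ⟨hm, hpm⟩, ?_⟩
  rintro m' ⟨hm', hpm'⟩
  by_contra hne
  obtain ⟨e, he, h1, h2⟩ := h ⟨m', hm'⟩ ⟨m, hm⟩ fun h' => hne (congrArg (·.asIdeal) h')
  rcases mem_or_one_sub_mem (p := p) he with h' | h'
  · exact one_sub_notMem (hpm h') h2
  · exact one_sub_notMem h1 (hpm' h')

/-- If the product of the two complements missed `0`, a prime disjoint from it would lie in both `m`
and `m'`. This is the Hausdorff property of `Max A` in algebraic form. -/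
theorem IsGelfand.exists_mul_eq_zero (h : IsGelfand A) {m m' : Ideal A} (hm : m.IsMaximal)
    (hm' : m'.IsMaximal) (hne : m ≠ m') : ∃ a ∉ m, ∃ b ∉ m', a * b = 0 := by
  by_contra! hcon
  obtain ⟨p, hp, -, hdisj⟩ := Ideal.exists_le_prime_disjoint (⊥ : Ideal A)
    (m.primeCompl ⊔ m'.primeCompl) (by
      rw [Set.disjoint_left]
      intro x hx hx'
      obtain ⟨a, ha, b, hb, hab⟩ := Submonoid.mem_sup.1 hx'
      exact hcon a ha b hb (hab.trans hx))
  rw [Set.disjoint_left] at hdisj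
  refine hne ((h p hp).unique ⟨hm, fun x hx => ?_⟩ ⟨hm', fun x hx => ?_⟩)
  · by_contra hxm
    exact hdisj hx ((le_sup_left : m.primeCompl ≤ m.primeCompl ⊔ m'.primeCompl) hxm)
  · by_contra hxm
    exact hdisj hx ((le_sup_right : m'.primeCompl ≤ m.primeCompl ⊔ m'.primeCompl) hxm)

theorem IsGelfand.eq_of_kerLoc_le (h : IsGelfand A) {m m' : Ideal A} [hm : m.IsMaximal]
    (hm' : m'.IsMaximal) (hle : kerLoc m ≤ m') : m' = m := by
  by_contra hne
  obtain ⟨a, ha, b, hb, hab⟩ := h.exists_mul_eq_zero hm' hm hne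
  exact ha (hle (mem_kerLoc_iff.2 ⟨b, hb, by rw [mul_comm, hab]⟩))

theorem IsExchange.isRegularIdeal_kerLoc (h : IsExchange A) (m : Ideal A) [hm : m.IsMaximal] :
    IsRegularIdeal (kerLoc m) := by
  refine ⟨{e | e ∈ kerLoc m ∧ IsIdempotentElem e}, fun e he => he.2,
    le_antisymm (fun a ha => ?_) (Ideal.span_le.2 fun e he => he.1)⟩
  obtain ⟨s, hs, hsa⟩ := mem_kerLoc_iff.1 ha
  obtain ⟨e, he, hi, hem⟩ := h.exists_notMem hm hs
  obtain ⟨c, hc⟩ := Ideal.mem_span_singleton'.1 he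
  have : a = a * (1 - e) := by linear_combination c * hsa - a * hc
  rw [this]
  exact Ideal.mul_mem_left _ _ (Ideal.subset_span
    ⟨(mem_kerLoc_iff_of_isIdempotentElem hi.one_sub).2
      ((mem_or_one_sub_mem hi).resolve_left hem), hi.one_sub⟩)

theorem IsGelfand.idempotentsSeparateMax_of_isRegularIdeal_kerLoc (h : IsGelfand A)
    (hreg : ∀ m : MaximalSpectrum A, IsRegularIdeal (kerLoc m.asIdeal)) :
    IdempotentsSeparateMax A := by
  intro m m' hne
  obtain ⟨S, hS, hker⟩ := hreg m
  have hnle : ¬ kerLoc m.asIdeal ≤ m'.asIdeal := fun hle =>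
    hne (MaximalSpectrum.ext (h.eq_of_kerLoc_le m'.isMaximal hle)).symm
  rw [hker, Ideal.span_le, Set.not_subset] at hnle
  obtain ⟨e, he, hem'⟩ := hnle
  exact ⟨e, hS e he, kerLoc_le _ (hker ▸ Ideal.subset_span he),
    (mem_or_one_sub_mem (hS e he)).resolve_left hem'⟩

/-- Purity gives `a = a * b` with `b ∈ I`. Exchange for `b` gives an idempotent `e ∈ I` with `1 - e`
a multiple of `1 - b`, which kills `a`. -/
theorem IsExchange.isRegularIdeal_of_pure (h : IsExchange A) (I : Ideal A) (hI : I.Pure) :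
    IsRegularIdeal I := by
  refine ⟨{e | e ∈ I ∧ IsIdempotentElem e}, fun e he => he.2,
    le_antisymm (fun a ha => ?_) (Ideal.span_le.2 fun e he => he.1)⟩
  obtain ⟨b, hb, hab⟩ := Ideal.exists_eq_mul_of_pure ha
  obtain ⟨e, hi, h1, h2⟩ := h b
  obtain ⟨c, hc⟩ := Ideal.mem_span_singleton'.1 h2
  have : a = a * e := by linear_combination c * hab - a * hc
  rw [this]
  exact Ideal.mul_mem_left _ _ (Ideal.subset_span
    ⟨(Ideal.span_singleton_le_iff_mem I).2 hb h1, hi⟩)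

/-- Only `m` lies above `kerLoc m`, so an annihilator `s ∉ m` of `a` is invertible modulo `kerLoc
m`; hence `a = b * a` with `b ∈ kerLoc m`. -/
theorem IsGelfand.pure_kerLoc (h : IsGelfand A) (m : Ideal A) [hm : m.IsMaximal] :
    (kerLoc m).Pure := by
  refine Ideal.Pure.of_inf_eq_mul _ fun J _ => le_antisymm ?_ Ideal.mul_le_inf
  rintro a ⟨ha, haJ⟩
  obtain ⟨s, hs, hsa⟩ := mem_kerLoc_iff.1 ha
  have htop : Ideal.span {s} ⊔ kerLoc m = ⊤ := by
    by_contra hne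
    obtain ⟨m', hm', hle⟩ := Ideal.exists_le_maximal _ hne
    obtain rfl := h.eq_of_kerLoc_le hm' (le_sup_right.trans hle)
    exact hs (hle (Ideal.mem_sup_left (Ideal.mem_span_singleton_self s)))
  obtain ⟨c, b, hb, hcb⟩ := Ideal.mem_span_singleton_sup.1 ((Ideal.eq_top_iff_one _).1 htop)
  have : a = b * a := by linear_combination c * hsa - a * hcb
  rw [this]
  exact Ideal.mul_mem_mul hb haJ

/-- In a Gelfand ring, ideals `I` and `J` such that every maximal ideal contains exactly one of
them are separated by an idempotent. -/
theorem IsGelfand.exists_isIdempotentElem (h : IsGelfand A) {I J : Ideal A}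
    (hor : ∀ m : Ideal A, m.IsMaximal → I ≤ m ∨ J ≤ m)
    (hnot : ∀ m : Ideal A, m.IsMaximal → ¬ (I ≤ m ∧ J ≤ m)) :
    ∃ e : A, IsIdempotentElem e ∧ (∀ m : Ideal A, m.IsMaximal → I ≤ m → 1 - e ∈ m) ∧
      ∀ m : Ideal A, m.IsMaximal → J ≤ m → e ∈ m := by
  -- `T` is the kernel of localization at `1 + I`.
  let T : Ideal A :=
    { carrier := {s | ∃ x, 1 - x ∈ I ∧ s * x = 0}
      zero_mem' := ⟨1, by simp, by simp⟩
      add_mem' := by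
        rintro s t ⟨x, hx, hsx⟩ ⟨y, hy, hty⟩
        refine ⟨x * y, ?_, by linear_combination y * hsx + x * hty⟩
        have : 1 - x * y = (1 - x) + x * (1 - y) := by ring
        rw [this]
        exact add_mem hx (I.mul_mem_left _ hy)
      smul_mem' := by
        rintro c s ⟨x, hx, hsx⟩
        exact ⟨x, hx, by rw [smul_eq_mul, mul_assoc, hsx, mul_zero]⟩ }
  have hTJ : T ⊔ J = ⊤ := by
    by_contra hne
    obtain ⟨m, hm, hle⟩ := Ideal.exists_le_maximal _ hne
    have htop : I ⊔ kerLoc m = ⊤ := by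
      by_contra hne'
      obtain ⟨m', hm', hle'⟩ := Ideal.exists_le_maximal _ hne'
      obtain rfl := h.eq_of_kerLoc_le hm' (le_sup_right.trans hle')
      exact hnot m' hm' ⟨le_sup_left.trans hle', le_sup_right.trans hle⟩
    obtain ⟨i, hi, x, hx, hix⟩ := Submodule.mem_sup.1 ((Ideal.eq_top_iff_one _).1 htop)
    obtain ⟨s, hs, hsx⟩ := mem_kerLoc_iff.1 hx
    exact hs (hle (Ideal.mem_sup_left ⟨x, by rwa [← hix, add_sub_cancel_right], hsx⟩))
  obtain ⟨y, ⟨x, hx, hyx⟩, j, hj, hyj⟩ :=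
    Submodule.mem_sup.1 ((Ideal.eq_top_iff_one _).1 hTJ)
  have hy : 1 - y ∈ J := by rwa [← hyj, add_sub_cancel_left]
  -- Here `x` is `1` modulo `I`, `y` is `1` modulo `J`, and `y * x = 0`. Once they are comaximal, `1
  -- = a * x + b * y` is a sum of orthogonal idempotents.
  have htop : Ideal.span {x} ⊔ Ideal.span {y} = ⊤ := by
    by_contra hne
    obtain ⟨m, hm, hle⟩ := Ideal.exists_le_maximal _ hne
    rcases hor m hm with h' | h'
    · exact one_sub_notMem (hle (Ideal.mem_sup_left (Ideal.mem_span_singleton_self x))) (h' hx)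
    · exact one_sub_notMem (hle (Ideal.mem_sup_right (Ideal.mem_span_singleton_self y))) (h' hy)
  obtain ⟨a, g, hg, hag⟩ := Ideal.mem_span_singleton_sup.1 ((Ideal.eq_top_iff_one _).1 htop)
  obtain ⟨b, rfl⟩ := Ideal.mem_span_singleton'.1 hg
  refine ⟨a * x, ?_, fun m hm hI => ?_, fun m hm hJ => ?_⟩
  · change a * x * (a * x) = a * x
    linear_combination a * x * hag - a * b * hyx
  · rw [← hag, add_sub_cancel_left]
    refine m.mul_mem_left _ ((hm.isPrime.mem_or_mem (hyx ▸ m.zero_mem : y * x ∈ m)).resolve_right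
      (notMem_of_one_sub_mem (hI hx)))
  · exact m.mul_mem_left _ ((hm.isPrime.mem_or_mem
      (hyx ▸ m.zero_mem : y * x ∈ m)).resolve_left (notMem_of_one_sub_mem (hJ hy)))

/-! ### The maximal spectrum -/

/-- Open sets are stable under generalization and every prime specializes to a maximal ideal, so
opens covering `Max A` cover the compact space `Spec A`. -/
instance compactSpace_maximalSpectrum : CompactSpace (MaximalSpectrum A) := by
  have hind : IsInducing (MaximalSpectrum.toPrimeSpectrum (R := A)) := ⟨rfl⟩
  refine ⟨hind.isCompact_iff.2 (isCompact_of_finite_subcover fun {ι} U hU hcov => ?_)⟩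
  obtain ⟨t, ht⟩ := isCompact_univ.elim_finite_subcover U hU fun p _ => by
    obtain ⟨m, hm, hpm⟩ := Ideal.exists_le_maximal p.asIdeal p.isPrime.ne_top
    obtain ⟨i, hi⟩ := Set.mem_iUnion.1 (hcov ⟨⟨m, hm⟩, trivial, rfl⟩)
    refine Set.mem_iUnion.2 ⟨i, (hU i).stableUnderGeneralization ?_ hi⟩
    exact (le_iff_specializes p _).1 hpm
  exact ⟨t, (Set.subset_univ _).trans ht⟩

theorem isOpen_basicOpen_max (f : A) :
    IsOpen (MaximalSpectrum.toPrimeSpectrum ⁻¹' (basicOpen f : Set (PrimeSpectrum A))) :=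
  (basicOpen f).isOpen.preimage MaximalSpectrum.toPrimeSpectrum_continuous

theorem exists_basicOpen_subset_max {U : Set (MaximalSpectrum A)} (hU : IsOpen U)
    {m : MaximalSpectrum A} (hm : m ∈ U) :
    ∃ f ∉ m.asIdeal, ∀ m' : MaximalSpectrum A, f ∉ m'.asIdeal → m' ∈ U := by
  obtain ⟨V, hV, rfl⟩ := isOpen_induced_iff.1 hU
  obtain ⟨_, ⟨f, rfl⟩, h1, h2⟩ :=
    isTopologicalBasis_basic_opens.exists_subset_of_mem_open hm hV
  exact ⟨f, h1, fun m' hm' => h2 hm'⟩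

theorem exists_ideal_of_isClosed_max {F : Set (MaximalSpectrum A)} (hF : IsClosed F) :
    ∃ I : Ideal A, ∀ m : MaximalSpectrum A, m ∈ F ↔ I ≤ m.asIdeal := by
  obtain ⟨Z, hZ, rfl⟩ := isClosed_induced_iff.1 hF
  obtain ⟨I, rfl⟩ := (isClosed_iff_zeroLocus_ideal Z).1 hZ
  exact ⟨I, fun m => Iff.rfl⟩

theorem IsGelfand.t2Space (h : IsGelfand A) : T2Space (MaximalSpectrum A) := by
  refine ⟨fun m m' hne => ?_⟩
  obtain ⟨a, ha, b, hb, hab⟩ := h.exists_mul_eq_zero m.isMaximal m'.isMaximal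
    fun h' => hne (MaximalSpectrum.ext h')
  refine ⟨_, _, isOpen_basicOpen_max a, isOpen_basicOpen_max b, ha, hb, ?_⟩
  refine Set.disjoint_left.2 fun n hna hnb => ?_
  exact (n.isMaximal.isPrime.mem_or_mem
    (hab ▸ n.asIdeal.zero_mem : a * b ∈ n.asIdeal)).elim hna hnb

theorem IdempotentsSeparateMax.totallyDisconnectedSpace (h : IdempotentsSeparateMax A) :
    TotallyDisconnectedSpace (MaximalSpectrum A) := by
  have : TotallySeparatedSpace (MaximalSpectrum A) := by
    refine ⟨fun m _ m' _ hne => ?_⟩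
    obtain ⟨e, he, h1, h2⟩ := h m m' hne
    refine ⟨_, _, isOpen_basicOpen_max (1 - e), isOpen_basicOpen_max e, one_sub_notMem h1,
      notMem_of_one_sub_mem h2, fun n _ => ?_, ?_⟩
    · by_cases hn : e ∈ n.asIdeal
      · exact Or.inl (one_sub_notMem hn)
      · exact Or.inr hn
    · exact Set.disjoint_left.2 fun n hn hn' => (mem_or_one_sub_mem he).elim hn' hn
  infer_instance

/-- `Max A` is compact Hausdorff, so total disconnectedness supplies a clopen set separating `m`
from `m'`. -/
theorem IsGelfand.idempotentsSeparateMax_of_totallyDisconnectedSpace (h : IsGelfand A)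
    [TotallyDisconnectedSpace (MaximalSpectrum A)] : IdempotentsSeparateMax A := by
  have := h.t2Space
  intro m m' hne
  obtain ⟨V, hV, hmV, hVm'⟩ := compact_exists_isClopen_in_isOpen
    (isOpen_compl_singleton (x := m')) (Set.mem_compl_singleton_iff.2 hne)
  obtain ⟨J, hJ⟩ := exists_ideal_of_isClosed_max hV.isClosed
  obtain ⟨I, hI⟩ := exists_ideal_of_isClosed_max hV.compl.isClosed
  obtain ⟨e, he, h1, h2⟩ := h.exists_isIdempotentElem (I := I) (J := J)
    (fun n hn => (em (MaximalSpectrum.mk n hn ∈ V)).symm.imp (hI ⟨n, hn⟩).1 (hJ ⟨n, hn⟩).1)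
    (fun n hn hIJ => (hI ⟨n, hn⟩).2 hIJ.1 ((hJ ⟨n, hn⟩).2 hIJ.2))
  exact ⟨e, he, h2 _ m.isMaximal ((hJ m).1 hmV),
    h1 _ m'.isMaximal ((hI m').1 fun hm' => hVm' hm' rfl)⟩

theorem IsExchange.isTopologicalBasis_max (h : IsExchange A) :
    TopologicalSpace.IsTopologicalBasis
      {U : Set (MaximalSpectrum A) | ∃ e : A, IsIdempotentElem e ∧
        U = MaximalSpectrum.toPrimeSpectrum ⁻¹' (basicOpen e)} := by
  refine TopologicalSpace.isTopologicalBasis_of_isOpen_of_nhds ?_ fun m U hm hU => ?_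
  · rintro _ ⟨e, -, rfl⟩
    exact isOpen_basicOpen_max e
  · obtain ⟨f, hf, hfU⟩ := exists_basicOpen_subset_max hU hm
    obtain ⟨e, hef, he, hem⟩ := h.exists_notMem m.isMaximal hf
    exact ⟨_, ⟨e, he, rfl⟩, hem, fun m' hm' => hfU m' fun hf' =>
      hm' ((Ideal.span_singleton_le_iff_mem _).2 hf' hef)⟩

theorem idempotentsSeparateMax_of_isTopologicalBasis
    (h : TopologicalSpace.IsTopologicalBasis
      {U : Set (MaximalSpectrum A) | ∃ e : A, IsIdempotentElem e ∧
        U = MaximalSpectrum.toPrimeSpectrum ⁻¹' (basicOpen e)}) :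
    IdempotentsSeparateMax A := by
  intro m m' hne
  obtain ⟨_, ⟨e, he, rfl⟩, h1, h2⟩ := h.exists_subset_of_mem_open
    (Set.mem_compl_singleton_iff.2 hne.symm) (isOpen_compl_singleton (x := m))
  exact ⟨e, he, by_contra fun h' => h2 h' rfl, (mem_or_one_sub_mem he).resolve_left h1⟩

/-! ### The Pierce spectrum -/

theorem continuous_maxToPierce : Continuous (maxToPierce A) := by
  refine continuous_generateFrom_iff.2 ?_
  rintro _ ⟨e, he, rfl⟩
  convert isOpen_basicOpen_max e using 1
  ext m
  exact not_congr (mem_idemPart_iff he)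

theorem surjective_maxToPierce : Function.Surjective (maxToPierce A) := by
  rintro ⟨M, hM⟩
  obtain ⟨m, hm, hle⟩ := Ideal.exists_le_maximal M hM.prop.1
  obtain ⟨S, hS, hMS⟩ := hM.prop.2
  refine ⟨⟨m, hm⟩, Subtype.ext (hM.eq_of_le (isMaxRegular_idemPart m).prop ?_).symm⟩
  rw [hMS, Ideal.span_le]
  exact fun e he => (mem_idemPart_iff (hS e he)).2 (hle (hMS ▸ Ideal.subset_span he))

/-- By maximality, an inclusion between max-regular ideals is an equality, so two maximal ideals
have the same image exactly when no idempotent separates them. -/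
theorem injective_maxToPierce_iff :
    Function.Injective (maxToPierce A) ↔ IdempotentsSeparateMax A := by
  constructor
  · intro h m m' hne
    by_contra! hcon
    refine hne (h (Subtype.ext ((isMaxRegular_idemPart m.asIdeal).eq_of_le
      (isMaxRegular_idemPart m'.asIdeal).prop (idemPart_le_iff.2 fun e he hi => ?_))))
    exact (mem_idemPart_iff hi).2 ((mem_or_one_sub_mem hi).resolve_right (hcon e hi he))
  · intro h m m' heq
    by_contra hne
    obtain ⟨e, he, h1, h2⟩ := h m m' hne
    have heq : idemPart m.asIdeal = idemPart m'.asIdeal := congrArg Subtype.val heq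
    exact one_sub_notMem ((mem_idemPart_iff he).1 (heq ▸ (mem_idemPart_iff he).2 h1)) h2

theorem IsExchange.isHomeomorph_maxToPierce (h : IsExchange A) :
    IsHomeomorph (maxToPierce A) := by
  have hinj := injective_maxToPierce_iff.2 h.idempotentsSeparateMax
  refine ⟨continuous_maxToPierce, h.isTopologicalBasis_max.isOpenMap_iff.2 ?_, hinj,
    surjective_maxToPierce⟩
  rintro _ ⟨e, he, rfl⟩
  refine TopologicalSpace.isOpen_generateFrom_of_mem ⟨e, he, ?_⟩
  ext M
  obtain ⟨m, rfl⟩ := surjective_maxToPierce M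
  rw [hinj.mem_set_image]
  exact (not_congr (mem_idemPart_iff he)).symm

/-! ### Connected components of the prime spectrum -/

/-- Clopen sets are the `D(e)`, which bounds the component from above. The zero locus is connected:
idempotents of the quotient lift, and `p` contains `e` or `1 - e`, so each becomes `0` or `1`. -/
theorem connectedComponent_eq_zeroLocus (p : PrimeSpectrum A) :
    connectedComponent p = zeroLocus (idemPart p.asIdeal : Set A) := by
  apply Set.Subset.antisymm
  · intro q hq
    refine idemPart_le_iff.2 fun e he hi => ?_
    refine (mem_or_one_sub_mem hi).resolve_right fun h' => ?_
    have := (PrimeSpectrum.isClopen_iff.2 ⟨1 - e, hi.one_sub, rfl⟩ :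
      IsClopen (basicOpen (1 - e) : Set (PrimeSpectrum A))).connectedComponent_subset
        (one_sub_notMem he) hq
    exact this h'
  · refine IsPreconnected.subset_connectedComponent ?_ (idemPart_le p.asIdeal)
    have hpre : PreconnectedSpace (PrimeSpectrum (A ⧸ idemPart p.asIdeal)) := by
      refine preconnectedSpace_iff_clopen.2 fun s hs => ?_
      obtain ⟨x, hx, rfl⟩ := PrimeSpectrum.isClopen_iff.1 hs
      obtain ⟨e, he, rfl⟩ := idempotentsLift_idemPart _ x hx
      rcases mem_or_one_sub_mem (p := p.asIdeal) he with h | h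
      · left
        rw [Ideal.Quotient.eq_zero_iff_mem.2 ((mem_idemPart_iff he).2 h)]
        simp
      · right
        have := Ideal.Quotient.eq_zero_iff_mem.2 ((mem_idemPart_iff he.one_sub).2 h)
        rw [map_sub, map_one, sub_eq_zero] at this
        rw [← this]
        simp
    have hrange := range_comap_of_surjective _ (Ideal.Quotient.mk (idemPart p.asIdeal))
      Ideal.Quotient.mk_surjective
    rw [Ideal.mk_ker] at hrange
    rw [← hrange]
    exact isPreconnected_range (continuous_comap _)

theorem connectedComponent_toPrimeSpectrum (m : MaximalSpectrum A) :
    connectedComponent m.toPrimeSpectrum = zeroLocus (idemPart m.asIdeal : Set A) := by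
  rw [connectedComponent_eq_zeroLocus]
  rfl

theorem IdempotentsSeparateMax.zeroLocus_idemPart (h : IdempotentsSeparateMax A)
    (m : MaximalSpectrum A) :
    zeroLocus (idemPart m.asIdeal : Set A) = Lam m.toPrimeSpectrum := by
  ext q
  rw [mem_Lam_iff]
  constructor
  · intro hq
    obtain ⟨m', hm', hle⟩ := Ideal.exists_le_maximal q.asIdeal q.isPrime.ne_top
    by_cases hne : m = ⟨m', hm'⟩
    · subst hne
      exact hle
    · obtain ⟨e, he, h1, h2⟩ := h m ⟨m', hm'⟩ hne
      exact absurd h2 (one_sub_notMem (hle (hq ((mem_idemPart_iff he).2 h1))))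
  · intro hq
    have h' : idemPart q.asIdeal = idemPart m.asIdeal :=
      idemPart_eq_of_le (q := m.toPrimeSpectrum.asIdeal) hq
    rw [← h']
    exact idemPart_le q.asIdeal

/-- The component of `m` is the zero locus of `idemPart m`. If it equals `Lam m`, it omits every
other maximal ideal, so some idempotent of `m` lies outside `m'`. -/
theorem connectedComponents_eq_Lam_iff :
    {C : Set (PrimeSpectrum A) | ∃ x : PrimeSpectrum A, C = connectedComponent x} =
      {C : Set (PrimeSpectrum A) | ∃ m : MaximalSpectrum A, C = Lam m.toPrimeSpectrum} ↔
    IdempotentsSeparateMax A := by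
  constructor
  · intro h m m' hne
    obtain ⟨x, hx⟩ := h.ge ⟨m, rfl⟩
    have hm : m.toPrimeSpectrum ∈ Lam m.toPrimeSpectrum := (mem_Lam_iff _ _).2 le_rfl
    rw [hx] at hm
    have hx' : Lam m.toPrimeSpectrum = zeroLocus (idemPart m.asIdeal : Set A) := by
      rw [hx, connectedComponent_eq hm, connectedComponent_toPrimeSpectrum]
    have hnle : ¬ idemPart m.asIdeal ≤ m'.asIdeal := fun hle => by
      have : m'.toPrimeSpectrum ∈ Lam m.toPrimeSpectrum := hx' ▸ hle
      exact hne (MaximalSpectrum.ext (m'.isMaximal.eq_of_le m.isMaximal.ne_top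
        ((mem_Lam_iff _ _).1 this)).symm)
    rw [idemPart_le_iff] at hnle
    push Not at hnle
    obtain ⟨e, he, hi, he'⟩ := hnle
    exact ⟨e, hi, he, (mem_or_one_sub_mem hi).resolve_left he'⟩
  · intro h
    apply Set.Subset.antisymm
    · rintro _ ⟨x, rfl⟩
      obtain ⟨m, hm, hle⟩ := Ideal.exists_le_maximal x.asIdeal x.isPrime.ne_top
      refine ⟨⟨m, hm⟩, ?_⟩
      rw [connectedComponent_eq_zeroLocus, ← h.zeroLocus_idemPart, idemPart_eq_of_le hle]
    · rintro _ ⟨m, rfl⟩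
      exact ⟨m.toPrimeSpectrum, by
        rw [connectedComponent_toPrimeSpectrum, h.zeroLocus_idemPart]⟩

/-! ### Systems of polynomial equations -/

section Systems

variable {B : Type v} [CommRing B] [Algebra A B]

theorem algebraMap_locAt_eq_one {m : MaximalSpectrum A} {e : A} (he : IsIdempotentElem e)
    (hem : e ∉ m.asIdeal) : algebraMap B (LocAt B m) (algebraMap A B e) = 1 := by
  have hu : IsUnit (algebraMap B (LocAt B m) (algebraMap A B e)) :=
    IsLocalization.map_units (LocAt B m)
      (⟨_, e, hem, rfl⟩ : Algebra.algebraMapSubmonoid B m.asIdeal.primeCompl)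
  refine hu.mul_left_cancel ?_
  rw [← map_mul, ← map_mul, he.eq, mul_one]

/-- If `e = r * s` is an idempotent outside `m`, then `e` maps to `1`, so `r` already supplies the
inverse of the denominator `s`. -/
theorem IsExchange.surjective_algebraMap_locAt (h : IsExchange A) (m : MaximalSpectrum A) :
    Function.Surjective (algebraMap B (LocAt B m)) := by
  intro z
  obtain ⟨b, ⟨_, s, hs, rfl⟩, rfl⟩ :=
    IsLocalization.exists_mk'_eq (Algebra.algebraMapSubmonoid B m.asIdeal.primeCompl) z
  obtain ⟨e, hes, he, hem⟩ := h.exists_notMem m.isMaximal hs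
  obtain ⟨r, hr⟩ := Ideal.mem_span_singleton'.1 hes
  refine ⟨b * algebraMap A B r, IsLocalization.eq_mk'_iff_mul_eq.2 ?_⟩
  rw [← map_mul, mul_assoc, ← map_mul, hr, map_mul, algebraMap_locAt_eq_one he hem, mul_one]

theorem IsExchange.exists_mul_eq_zero (h : IsExchange A) {m : MaximalSpectrum A} {ι : Type*}
    [Finite ι] {b : ι → B} (hb : ∀ i, algebraMap B (LocAt B m) (b i) = 0) :
    ∃ e : A, IsIdempotentElem e ∧ e ∉ m.asIdeal ∧ ∀ i, algebraMap A B e * b i = 0 := by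
  cases nonempty_fintype ι
  have hs : ∀ i, ∃ s ∉ m.asIdeal, algebraMap A B s * b i = 0 := fun i => by
    obtain ⟨⟨_, s, hs, rfl⟩, h'⟩ := (IsLocalization.map_eq_zero_iff
      (Algebra.algebraMapSubmonoid B m.asIdeal.primeCompl) (LocAt B m) (b i)).1 (hb i)
    exact ⟨s, hs, h'⟩
  choose s hsm hsb using hs
  obtain ⟨e, hes, he, hem⟩ := h.exists_notMem m.isMaximal (s := ∏ i, s i)
    (m.asIdeal.primeCompl.prod_mem fun i _ => hsm i)
  refine ⟨e, he, hem, fun i => ?_⟩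
  have hdvd : s i ∣ e :=
    (Finset.dvd_prod_of_mem s (Finset.mem_univ i)).trans (Ideal.mem_span_singleton.1 hes)
  obtain ⟨c, rfl⟩ := hdvd
  rw [map_mul, mul_right_comm, hsb, zero_mul]

theorem mul_aeval_eq_of_mul_eq {σ : Type*} {e : B} {c c' : σ → B}
    (hc : ∀ j, e * c j = e * c' j) (f : MvPolynomial σ B) :
    e * MvPolynomial.aeval c f = e * MvPolynomial.aeval c' f := by
  induction f using MvPolynomial.induction_on with
  | C a => simp
  | add p q hp hq => rw [map_add, map_add, mul_add, mul_add, hp, hq]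
  | mul_X p j hp =>
    simp only [map_mul, MvPolynomial.aeval_X]
    linear_combination c j * hp + MvPolynomial.aeval c' p * hc j

theorem IsExchange.hasSolution (h : IsExchange A) {n d : ℕ}
    (f : Fin d → MvPolynomial (Fin n) B)
    (hf : ∀ m : MaximalSpectrum A, HasSolution f (LocAt B m)) : HasSolution f B := by
  let S : Set A := {e | IsIdempotentElem e ∧
    ∃ c : Fin n → B, ∀ i, algebraMap A B e * MvPolynomial.aeval c (f i) = 0}
  have htop : Ideal.span S = ⊤ := by
    by_contra hne
    obtain ⟨m, hm, hle⟩ := Ideal.exists_le_maximal _ hne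
    obtain ⟨c, hc⟩ := hf ⟨m, hm⟩
    choose c' hc' using fun j => h.surjective_algebraMap_locAt (B := B) ⟨m, hm⟩ (c j)
    obtain rfl : algebraMap B (LocAt B ⟨m, hm⟩) ∘ c' = c := funext hc'
    obtain ⟨e, he, hem, heb⟩ := h.exists_mul_eq_zero (m := ⟨m, hm⟩)
      (b := fun i => MvPolynomial.aeval c' (f i)) fun i => by
        rw [← MvPolynomial.aeval_algebraMap_apply]
        exact hc i
    exact hem (hle (Ideal.subset_span ⟨he, c', heb⟩))
  -- `S` is closed under joins: the glued tuple agrees with `c` on `e` and with `c'` on `1 - e`, and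
  -- the join is `e + (1 - e) * e'`. Absorbing `1` then forces the witness to be `1`.
  obtain ⟨e, ⟨-, c, hc⟩, he1⟩ := exists_mul_eq_of_mem_span (S := S) (fun e he => he.1)
    ⟨IsIdempotentElem.zero, 0, by simp⟩ (by
      rintro e ⟨he, c, hc⟩ e' ⟨he', c', hc'⟩
      refine ⟨isIdempotentElem_join he he',
        fun j => algebraMap A B e * c j + (1 - algebraMap A B e) * c' j, fun i => ?_⟩
      have hE : algebraMap A B e * algebraMap A B e = algebraMap A B e := by
        rw [← map_mul, he.eq]
      have h1 := mul_aeval_eq_of_mul_eq (e := algebraMap A B e) (c' := c)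
        (c := fun j => algebraMap A B e * c j + (1 - algebraMap A B e) * c' j)
        (fun j => by linear_combination (c j - c' j) * hE) (f i)
      have h2 := mul_aeval_eq_of_mul_eq (e := 1 - algebraMap A B e) (c' := c')
        (c := fun j => algebraMap A B e * c j + (1 - algebraMap A B e) * c' j)
        (fun j => by linear_combination (c' j - c j) * hE) (f i)
      simp only [map_add, map_sub, map_mul]
      linear_combination h1 + hc i + algebraMap A B e' * h2 + (1 - algebraMap A B e) * hc' i)
    ((Ideal.eq_top_iff_one _).1 htop)
  refine ⟨c, fun i => ?_⟩
  rw [one_mul] at he1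
  simpa [he1] using hc i

end Systems

/-- Exchange for `a` is itself a system: `X * a` is idempotent and `1 - X * a = Y * (1 - a)`.
Locally `a` or `1 - a` is invertible, giving `(a⁻¹, 0)` or `(0, (1 - a)⁻¹)`. The algebra is `A`
itself, lifted to the required universe. -/
theorem isExchange_of_hasSolution
    (h : ∀ (B : Type (max u v)) [CommRing B] [Algebra A B] (n d : ℕ)
      (f : Fin d → MvPolynomial (Fin n) B),
      (∀ m : MaximalSpectrum A, HasSolution f (LocAt B m)) → HasSolution f B) :
    IsExchange A := by
  intro a
  let b : ULift.{v} A := ⟨a⟩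
  let f : Fin 2 → MvPolynomial (Fin 2) (ULift.{v} A) :=
    ![(.X 0 * .C b) * (.X 0 * .C b) - .X 0 * .C b, 1 - .X 0 * .C b - .X 1 * (1 - .C b)]
  have hunit : ∀ (m : MaximalSpectrum A) (s : A), s ∉ m.asIdeal →
      ∃ t : LocAt (ULift.{v} A) m, t * algebraMap (ULift.{v} A) _ ⟨s⟩ = 1 := fun m s hs =>
    (IsLocalization.map_units (LocAt (ULift.{v} A) m) (⟨_, s, hs, rfl⟩ :
      Algebra.algebraMapSubmonoid (ULift.{v} A) m.asIdeal.primeCompl)).exists_left_inv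
  obtain ⟨c, hc⟩ := h (ULift.{v} A) 2 2 f fun m => by
    by_cases ha : a ∈ m.asIdeal
    · obtain ⟨t, ht⟩ := hunit m (1 - a) (one_sub_notMem ha)
      have ht : t * (1 - algebraMap (ULift.{v} A) _ b) = 1 := by
        rw [← map_one (algebraMap (ULift.{v} A) (LocAt (ULift.{v} A) m)), ← map_sub]
        exact ht.trans (map_one _).symm
      refine ⟨![0, t], Fin.forall_fin_two.2 ⟨by simp [f], ?_⟩⟩
      simp [f, ht]
    · obtain ⟨t, ht⟩ := hunit m a ha
      have ht : t * algebraMap (ULift.{v} A) _ b = 1 := ht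
      exact ⟨![t, 0], Fin.forall_fin_two.2 ⟨by simp [f, ht], by simp [f, ht]⟩⟩
  have h0 := congrArg ULift.down (hc 0)
  have h1 := congrArg ULift.down (hc 1)
  simp [f, b] at h0 h1
  refine ⟨(c 0).down * a, sub_eq_zero.1 h0, Ideal.mem_span_singleton'.2 ⟨_, rfl⟩,
    Ideal.mem_span_singleton'.2 ⟨(c 1).down, (sub_eq_zero.1 h1).symm⟩⟩

end CleanRing

theorem mainTheorem1 (A : Type u) [CommRing A] :
    List.TFAE [
      -- (i)
      ∀ (B : Type (max u v)) [CommRing B] [Algebra A B] (n d : ℕ)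
        (f : Fin d → MvPolynomial (Fin n) B),
        (∀ m : MaximalSpectrum A, CleanRing.HasSolution f (CleanRing.LocAt B m)) →
          CleanRing.HasSolution f B,
      -- (ii)
      CleanRing.IsClean A,
      -- (iii)
      ∀ m m' : MaximalSpectrum A, m ≠ m' →
        ∃ e : A, IsIdempotentElem e ∧ e ∈ m.asIdeal ∧ 1 - e ∈ m'.asIdeal,
      -- (iv)
      CleanRing.IsGelfand A ∧ TotallyDisconnectedSpace (MaximalSpectrum A),
      -- (v)
      CleanRing.IsGelfand A ∧
        ∀ m : MaximalSpectrum A, CleanRing.IsRegularIdeal (CleanRing.kerLoc m.asIdeal),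
      -- (vi)
      {C : Set (PrimeSpectrum A) | ∃ x : PrimeSpectrum A, C = connectedComponent x} =
        {C : Set (PrimeSpectrum A) | ∃ m : MaximalSpectrum A,
          C = CleanRing.Lam m.toPrimeSpectrum},
      -- (vii)
      CleanRing.IsExchange A,
      -- (viii)
      ∀ I : Ideal A, CleanRing.IdempotentsLift (Ideal.Quotient.mk I),
      -- (ix)
      ∀ m m' : MaximalSpectrum A, m ≠ m' →
        ∃ e : A, IsIdempotentElem e ∧ e ∈ CleanRing.kerLoc m.asIdeal ∧
          1 - e ∈ CleanRing.kerLoc m'.asIdeal,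
      -- (x)
      TopologicalSpace.IsTopologicalBasis
        {U : Set (MaximalSpectrum A) | ∃ e : A, IsIdempotentElem e ∧
          U = MaximalSpectrum.toPrimeSpectrum ⁻¹' (PrimeSpectrum.basicOpen e)},
      -- (xi)
      CleanRing.IsGelfand A ∧ ∀ I : Ideal A, I.Pure → CleanRing.IsRegularIdeal I,
      -- (xii)
      IsHomeomorph (CleanRing.maxToPierce A)] := by
  tfae_have 3 → 7 := CleanRing.IdempotentsSeparateMax.isExchange
  tfae_have 7 → 8 := CleanRing.IsExchange.idempotentsLift
  tfae_have 8 → 3 := CleanRing.idempotentsSeparateMax_of_lift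
  tfae_have 7 → 2 := CleanRing.IsExchange.isClean
  tfae_have 2 → 3 := CleanRing.IsClean.idempotentsSeparateMax
  tfae_have 3 ↔ 9 := CleanRing.idempotentsSeparateMax_iff_kerLoc
  tfae_have 7 → 10 := CleanRing.IsExchange.isTopologicalBasis_max
  tfae_have 10 → 3 := CleanRing.idempotentsSeparateMax_of_isTopologicalBasis
  tfae_have 3 → 4 := fun h =>
    ⟨CleanRing.IdempotentsSeparateMax.isGelfand h,
      CleanRing.IdempotentsSeparateMax.totallyDisconnectedSpace h⟩
  tfae_have 4 → 3 := fun ⟨h, _⟩ => h.idempotentsSeparateMax_of_totallyDisconnectedSpace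
  tfae_have 5 → 3 := fun h => h.1.idempotentsSeparateMax_of_isRegularIdeal_kerLoc h.2
  tfae_have 7 → 11 := fun h => ⟨h.idempotentsSeparateMax.isGelfand, h.isRegularIdeal_of_pure⟩
  tfae_have 7 → 5 := fun h =>
    ⟨h.idempotentsSeparateMax.isGelfand, fun m => h.isRegularIdeal_kerLoc m.asIdeal⟩
  tfae_have 11 → 5 := fun h => ⟨h.1, fun m => h.2 _ (h.1.pure_kerLoc m.asIdeal)⟩
  tfae_have 7 → 12 := CleanRing.IsExchange.isHomeomorph_maxToPierce
  tfae_have 12 → 3 := fun h => CleanRing.injective_maxToPierce_iff.1 h.injective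
  tfae_have 6 ↔ 3 := CleanRing.connectedComponents_eq_Lam_iff
  tfae_have 7 → 1 := fun h B _ _ n d f => h.hasSolution f
  tfae_have 1 → 7 := CleanRing.isExchange_of_hasSolution
  tfae_finish
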